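/- Consider the linear plant $\dot x = Ax+Bu+B_ww$, $z = Cx+Du$ with real matrices $A\in\mathbb R^{n\times n}$, $B\in\mathbb R^{n\times m}$, $B_w\in\mathbb R^{n\times \bar m}$, $C\in\mathbb R^{k\times n}$, $D\in\mathbb R^{k\times m}$. Assume that $(A,B)$ is stabilizable, $(C,A)$ is observable, $C^\top D=0$, $D^\top D$ is invertible, and $B_w\neq 0$. Let $S$ be the set of all $\alpha\in(0,\infty)$ for which the Riccati equation $$Q_\alpha A+A^\top Q_\alpha+\alpha Q_\alpha-\alpha Q_\alpha B(D^\top D)^{-1}B^\top Q_\alpha+\tfrac1\alpha C^\top C=0$$ has a positive definite solution, for $\alpha\in S$ let $Q_\alpha\succ0$ be such a solution, and put $f(\alpha)=\operatorname{tr}(B_w^\top Q_\alpha B_w)$ for $\alpha \in S$ (values $\alpha\in(0,\infty)\setminus S$ do not compete; one may put $f=+\infty$ there). Call $\hat\alpha\in[0,\infty]$ an infimizing parameter of $f$ if there are $\alpha_i\in S$ with $\alpha_i\to\hat\alpha$ and $f(\alpha_i)\to\inf_S f$. Then: 1. For every $\alpha\in S$ the positive definite solution $Q_\alpha$ is unique,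 and $S$ contains an interval $(0,\alpha_0)$ with $\alpha_0>0$. 2. The standard Riccati equation $\hat QA+A^\top\hat Q-\hat QB(D^\top D)^{-1}B^\top\hat Q+C^\top C=0$ has a unique positive definite solution $\hat Q$, and, as $\alpha\to0^+$, $\alpha Q_\alpha\to\hat Q$ and $\alpha f(\alpha)\to\operatorname{tr}(B_w^\top\hat QB_w)>0$; in particular $f(\alpha)\to+\infty$. 3. Infimizing parameters of $f$ exist, and every infimizing parameter $\hat\alpha$ satisfies $\hat\alpha\ne0$, that is, either $\hat\alpha\in(0,\infty)$ or $\hat\alpha=\infty$. If $\hat\alpha\in S$, then $f$ attains its minimum over $S$ at $\hat\alpha$. -/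

import Mathlib

open Filter Topology
open scoped Matrix

/-- A real square matrix is stable if all its complex eigenvalues have negative real part. -/
def IsStableMatrix {n : ℕ} (A : Matrix (Fin n) (Fin n) ℝ) : Prop :=
  ∀ μ ∈ spectrum ℂ (A.map (algebraMap ℝ ℂ)), μ.re < 0

/-- `(A, B)` is stabilizable: some static state feedback `u = K x` makes `A + B K` stable. -/
def IsStabilizable {n m : ℕ} (A : Matrix (Fin n) (Fin n) ℝ) (B : Matrix (Fin n) (Fin m) ℝ) :
    Prop :=
  ∃ K : Matrix (Fin m) (Fin n) ℝ, IsStableMatrix (A + B * K)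

/-- `(C, A)` is observable: a trajectory of `x' = A x` whose output `C x` vanishes identically
on `[0, ∞)` starts at `0`. -/
def IsObservable {n k : ℕ} (C : Matrix (Fin k) (Fin n) ℝ) (A : Matrix (Fin n) (Fin n) ℝ) :
    Prop :=
  ∀ x : ℝ → (Fin n → ℝ), (∀ t, HasDerivAt x (A *ᵥ x t) t) →
    (∀ t, 0 ≤ t → C *ᵥ x t = 0) → x 0 = 0

/-- `X` is a positive definite solution of the state-feedback Riccati equation with
parameter `α`. -/
def IsRiccatiSol {n m k : ℕ} (A : Matrix (Fin n) (Fin n) ℝ) (B : Matrix (Fin n) (Fin m) ℝ)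
    (C : Matrix (Fin k) (Fin n) ℝ) (D : Matrix (Fin k) (Fin m) ℝ) (α : ℝ)
    (X : Matrix (Fin n) (Fin n) ℝ) : Prop :=
  X.PosDef ∧
    X * A + Aᵀ * X + α • X - α • (X * B * (Dᵀ * D)⁻¹ * Bᵀ * X) + (1 / α) • (Cᵀ * C) = 0

/-- `X` is a positive definite solution of the standard algebraic Riccati equation. -/
def IsStandardARESol {n m k : ℕ} (A : Matrix (Fin n) (Fin n) ℝ) (B : Matrix (Fin n) (Fin m) ℝ)
    (C : Matrix (Fin k) (Fin n) ℝ) (D : Matrix (Fin k) (Fin m) ℝ)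
    (X : Matrix (Fin n) (Fin n) ℝ) : Prop :=
  X.PosDef ∧ X * A + Aᵀ * X - X * B * (Dᵀ * D)⁻¹ * Bᵀ * X + Cᵀ * C = 0

/-- The parameters `α ∈ (0, ∞)` for which the Riccati equation has a positive definite
solution. -/
def riccatiDomain {n m k : ℕ} (A : Matrix (Fin n) (Fin n) ℝ) (B : Matrix (Fin n) (Fin m) ℝ)
    (C : Matrix (Fin k) (Fin n) ℝ) (D : Matrix (Fin k) (Fin m) ℝ) : Set ℝ :=
  {α | 0 < α ∧ ∃ X, IsRiccatiSol A B C D α X}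

/-- The extended real `a` is an infimizing parameter of `f` over `S`: it is the limit of a
sequence in `S` along which `f` tends to its (finite) infimum over `S`. -/
def IsArginf (f : ℝ → ℝ) (S : Set ℝ) (a : EReal) : Prop :=
  ∃ γ : ℝ, IsGLB (f '' S) γ ∧ ∃ u : ℕ → ℝ, (∀ i, u i ∈ S) ∧
    Tendsto (fun i => (u i : EReal)) atTop (𝓝 a) ∧ Tendsto (fun i => f (u i)) atTop (𝓝 γ)

/-! With `P = α Q_α` the parametrized equation becomes the standard Riccati equation with drift `A +
(α/2) I`, while the quadratic term `G = B (DᵀD)⁻¹ Bᵀ` and the constant term `CᵀC` no longer depend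
on `α` (`riccati_rescale`). Everything is therefore a statement about one Riccati equation under a
shift of its drift.

Observability, which survives the shift, makes every semidefinite solution definite and stabilizing.
The difference of the solutions for two shifts then solves a Lyapunov equation with stable
coefficient and semidefinite source, so `P` increases with the shift (`IsPSDARESol.sub_posSemidef`);
equal shifts give uniqueness. Stabilizability survives small shifts, and Newton-Kleinman iteration
then produces a solution. Monotonicity bounds `P` near `α = 0`, so compactness and uniqueness give
`P → Qhat` (`IsPSDARESol.tendsto_of_bounded`). Thus `α f(α)` has a positive limit, `f` blows up at
`0`, and `0` cannot be infimizing, while compactness of the extended reals supplies infimizing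
parameters. -/

/-! ### Quadratic forms, and complex eigenvalues of real matrices -/

theorem posSemidef_real_iff {n : ℕ} {M : Matrix (Fin n) (Fin n) ℝ} :
    M.PosSemidef ↔ Mᵀ = M ∧ ∀ x : Fin n → ℝ, 0 ≤ x ⬝ᵥ M *ᵥ x := by
  rw [Matrix.posSemidef_iff_dotProduct_mulVec]
  simp [Matrix.IsHermitian, Matrix.conjTranspose_eq_transpose_of_trivial]

theorem tendsto_matrix_iff {ι R : Type*} [TopologicalSpace R] {n : ℕ} {l : Filter ι}
    {f : ι → Matrix (Fin n) (Fin n) R} {M : Matrix (Fin n) (Fin n) R} :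
    Tendsto f l (𝓝 M) ↔ ∀ i j, Tendsto (fun x => f x i j) l (𝓝 (M i j)) :=
  (tendsto_pi_nhds (f := fun x => (f x : Fin n → Fin n → R))).trans
    (forall_congr' fun _ => tendsto_pi_nhds)

theorem dotProduct_transpose_mul_mul_mulVec {n : ℕ} {ι κ : Type*} [Fintype ι] [Fintype κ]
    (P : Matrix ι κ ℝ) (X : Matrix ι (Fin n) ℝ) (R : Matrix (Fin n) κ ℝ) (v w : κ → ℝ) :
    v ⬝ᵥ (Pᵀ * X * R) *ᵥ w = (P *ᵥ v) ⬝ᵥ X *ᵥ (R *ᵥ w) := by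
  rw [← Matrix.mulVec_mulVec, ← Matrix.mulVec_mulVec, Matrix.dotProduct_mulVec,
    Matrix.vecMul_transpose]

theorem mem_spectrum_iff_exists_mulVec {n : ℕ} {M : Matrix (Fin n) (Fin n) ℂ} {μ : ℂ} :
    μ ∈ spectrum ℂ M ↔ ∃ v : Fin n → ℂ, v ≠ 0 ∧ M *ᵥ v = μ • v := by
  rw [← Matrix.spectrum_toLin', ← Module.End.hasEigenvalue_iff_mem_spectrum]
  constructor
  · intro h
    obtain ⟨v, hv⟩ := h.exists_hasEigenvector
    exact ⟨v, hv.2, by simpa using hv.apply_eq_smul⟩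
  · rintro ⟨v, hv, h⟩
    exact Module.End.hasEigenvalue_of_hasEigenvector (x := v)
      ⟨Module.End.mem_eigenspace_iff.2 (by simpa using h), hv⟩

/-- A complex eigenvalue of a real matrix, in terms of the real and imaginary parts of an
eigenvector. -/
theorem mem_spectrum_map_iff_exists_real {n : ℕ} {A : Matrix (Fin n) (Fin n) ℝ} {μ : ℂ} :
    μ ∈ spectrum ℂ (A.map (algebraMap ℝ ℂ)) ↔ ∃ a b : Fin n → ℝ, (a ≠ 0 ∨ b ≠ 0) ∧
      A *ᵥ a = μ.re • a - μ.im • b ∧ A *ᵥ b = μ.im • a + μ.re • b := by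
  have hre : ∀ v : Fin n → ℂ, ∀ i, ((A.map (algebraMap ℝ ℂ)) *ᵥ v) i
      = ⟨(A *ᵥ fun j => (v j).re) i, (A *ᵥ fun j => (v j).im) i⟩ := by
    intro v i
    apply Complex.ext <;> simp [Matrix.mulVec, dotProduct]
  rw [mem_spectrum_iff_exists_mulVec]
  constructor
  · rintro ⟨v, hv, h⟩
    refine ⟨fun j => (v j).re, fun j => (v j).im, ?_, ?_, ?_⟩
    · by_contra! hc
      apply hv
      ext i
      exact Complex.ext (congrFun hc.1 i) (congrFun hc.2 i)
    · ext i
      have := congrArg Complex.re (congrFun h i)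
      rw [hre] at this
      simpa using this
    · ext i
      have := congrArg Complex.im (congrFun h i)
      rw [hre] at this
      simp at this
      simp [this, add_comm]
  · rintro ⟨a, b, hab, h1, h2⟩
    refine ⟨fun j => ⟨a j, b j⟩, ?_, ?_⟩
    · intro h
      rcases hab with h' | h'
      · exact h' (funext fun i => congrArg Complex.re (congrFun h i))
      · exact h' (funext fun i => congrArg Complex.im (congrFun h i))
    · ext i
      rw [hre]
      apply Complex.ext
      · simp [h1]
      · simp [h2, add_comm]

/-! ### Lyapunov equations via the Cayley transform -/

section
attribute [local instance] Matrix.linftyOpNormedRing Matrix.linftyOpNormedAlgebra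

/-- By Gelfand's formula the powers are eventually dominated by `r ^ k` for some `r` strictly
between the spectral radius and `1`. -/
theorem tendsto_pow_zero_of_spectrum_norm_lt_one {n : ℕ} (M : Matrix (Fin n) (Fin n) ℂ)
    (h : ∀ μ ∈ spectrum ℂ M, ‖μ‖ < 1) : Tendsto (fun k : ℕ => M ^ k) atTop (𝓝 0) := by
  rcases subsingleton_or_nontrivial (Matrix (Fin n) (Fin n) ℂ) with hs | hs
  · exact tendsto_const_nhds.congr fun k => Subsingleton.elim _ _
  have : CompleteSpace (Matrix (Fin n) (Fin n) ℂ) := FiniteDimensional.complete ℂ _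
  have hρ : spectralRadius ℂ M < (1 : NNReal) :=
    spectrum.spectralRadius_lt_of_forall_lt M fun μ hμ => by exact_mod_cast h μ hμ
  obtain ⟨r, hr1, hr2⟩ := ENNReal.lt_iff_exists_nnreal_btwn.1 hρ
  have hG := spectrum.pow_nnnorm_pow_one_div_tendsto_nhds_spectralRadius M
  have hlt : ∀ᶠ k : ℕ in atTop, ‖M ^ k‖ ≤ (r : ℝ) ^ k := by
    filter_upwards [hG.eventually_lt_const hr1, eventually_gt_atTop 0] with k hk hk0
    have hk' := ENNReal.rpow_le_rpow hk.le (Nat.cast_nonneg k : (0 : ℝ) ≤ k)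
    rw [← ENNReal.rpow_mul, one_div_mul_cancel (by positivity), ENNReal.rpow_one,
      ENNReal.rpow_natCast] at hk'
    exact_mod_cast hk'
  exact squeeze_zero_norm' hlt (tendsto_pow_atTop_nhds_zero_of_lt_one r.2 (by exact_mod_cast hr2))

end

namespace IsStableMatrix

variable {n : ℕ} {F F₁ F₂ : Matrix (Fin n) (Fin n) ℝ}

theorem isUnit_one_sub (hF : IsStableMatrix F) : IsUnit (1 - F) := by
  rw [← Matrix.mulVec_injective_iff_isUnit, ← Matrix.coe_mulVecLin,
    ← LinearMap.ker_eq_bot, LinearMap.ker_eq_bot']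
  intro v hv
  by_contra hv0
  have hFv : F *ᵥ v = v := by
    rw [Matrix.mulVecLin_apply, Matrix.sub_mulVec, Matrix.one_mulVec, sub_eq_zero] at hv
    exact hv.symm
  have := hF 1 (mem_spectrum_map_iff_exists_real.2 ⟨v, 0, Or.inl hv0, by simp [hFv], by simp⟩)
  norm_num at this

/-- The Cayley transform carries the open left half-plane into the open unit disc. Its powers serve
as a discrete substitute for `exp (tF)`, so no integrals are needed for Lyapunov equations. -/
theorem tendsto_cayley_pow (hF : IsStableMatrix F) :
    Tendsto (fun k : ℕ => ((1 + F) * (1 - F)⁻¹) ^ k) atTop (𝓝 0) := by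
  set S := (1 + F) * (1 - F)⁻¹ with hS
  have hdet : IsUnit (1 - F).det := (Matrix.isUnit_iff_isUnit_det _).1 hF.isUnit_one_sub
  have hSF : S * (1 - F) = 1 + F := by
    rw [hS, Matrix.mul_assoc, Matrix.nonsing_inv_mul _ hdet, Matrix.mul_one]
  set φ : Matrix (Fin n) (Fin n) ℝ →+* Matrix (Fin n) (Fin n) ℂ := (algebraMap ℝ ℂ).mapMatrix
  have hφ : ∀ X, φ X = X.map (algebraMap ℝ ℂ) := fun X => rfl
  have hpow : Tendsto (fun k : ℕ => (φ S) ^ k) atTop (𝓝 0) := by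
    apply tendsto_pow_zero_of_spectrum_norm_lt_one
    intro μ hμ
    obtain ⟨v, hv, h⟩ := mem_spectrum_iff_exists_mulVec.1 hμ
    set w := φ ((1 - F)⁻¹) *ᵥ v with hw
    have hvw : v = (1 - φ F) *ᵥ w := by
      rw [hw, Matrix.mulVec_mulVec, ← map_one φ, ← map_sub, ← map_mul,
        Matrix.mul_nonsing_inv _ hdet, map_one, Matrix.one_mulVec]
    have hw0 : w ≠ 0 := by
      intro h0
      apply hv
      rw [hvw, h0, Matrix.mulVec_zero]
    have e : (1 + φ F) *ᵥ w = μ • ((1 - φ F) *ᵥ w) := by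
      rw [← hvw, ← h]
      conv_rhs => rw [hvw, Matrix.mulVec_mulVec, ← map_one φ, ← map_sub, ← map_mul, hSF, map_add,
        map_one]
    have e2 : (1 + μ) • (φ F *ᵥ w) = (μ - 1) • w := by
      rw [Matrix.add_mulVec, Matrix.sub_mulVec, Matrix.one_mulVec, smul_sub] at e
      rw [add_smul, one_smul, sub_smul, one_smul]
      linear_combination (exp := 1) e
    have hμ1 : 1 + μ ≠ 0 := by
      intro h0
      rw [h0, zero_smul] at e2
      rcases smul_eq_zero.1 e2.symm with h1 | h1
      · have : (2 : ℂ) = 0 := by linear_combination h0 - h1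
        norm_num at this
      · exact hw0 h1
    have hev : φ F *ᵥ w = ((μ - 1) / (1 + μ)) • w := by
      rw [div_eq_inv_mul, mul_smul, ← e2, smul_smul, inv_mul_cancel₀ hμ1, one_smul]
    -- The real part of `(μ - 1) / (1 + μ)` has the sign of `|μ|² - 1`.
    have hneg := hF _ (mem_spectrum_iff_exists_mulVec.2 ⟨w, hw0, hev⟩)
    have hns : 0 < Complex.normSq (1 + μ) := Complex.normSq_pos.2 hμ1
    rw [Complex.div_re, ← add_div, div_neg_iff] at hneg
    have h3 : (μ - 1).re * (1 + μ).re + (μ - 1).im * (1 + μ).im < 0 := by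
      rcases hneg with h' | h'
      · linarith [h'.2]
      · exact h'.1
    simp at h3
    have h4 : ‖μ‖ ^ 2 < 1 := by
      rw [← Complex.normSq_eq_norm_sq, Complex.normSq_apply]
      nlinarith
    nlinarith [norm_nonneg μ]
  rw [tendsto_matrix_iff] at hpow ⊢
  intro i j
  have h2 := (Complex.continuous_re.tendsto _).comp (hpow i j)
  refine h2.congr fun k => ?_
  rw [Function.comp_apply, ← map_pow]
  simp [hφ]

/-- The Cayley transform turns a Sylvester expression into a Stein expression. -/
theorem cayley_identity (h₁ : IsStableMatrix F₁) (h₂ : IsStableMatrix F₂)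
    (E : Matrix (Fin n) (Fin n) ℝ) :
    E = ((1 + F₁) * (1 - F₁)⁻¹)ᵀ * E * ((1 + F₂) * (1 - F₂)⁻¹) -
      2 • (((1 - F₁)⁻¹)ᵀ * (F₁ᵀ * E + E * F₂) * (1 - F₂)⁻¹) := by
  have d₁ : IsUnit (1 - F₁).det := (Matrix.isUnit_iff_isUnit_det _).1 h₁.isUnit_one_sub
  have d₂ : IsUnit (1 - F₂).det := (Matrix.isUnit_iff_isUnit_det _).1 h₂.isUnit_one_sub
  have e₁ : ((1 - F₁)⁻¹)ᵀ * (1 - F₁)ᵀ = 1 := by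
    rw [← Matrix.transpose_mul, Matrix.mul_nonsing_inv _ d₁, Matrix.transpose_one]
  have e₂ : (1 - F₂) * (1 - F₂)⁻¹ = 1 := Matrix.mul_nonsing_inv _ d₂
  have key : (1 - F₁)ᵀ * E * (1 - F₂) =
      (1 + F₁)ᵀ * E * (1 + F₂) - 2 • (F₁ᵀ * E + E * F₂) := by
    rw [Matrix.transpose_sub, Matrix.transpose_add, Matrix.transpose_one]
    noncomm_ring
  calc E = (((1 - F₁)⁻¹)ᵀ * (1 - F₁)ᵀ) * E * ((1 - F₂) * (1 - F₂)⁻¹) := by rw [e₁, e₂]; simp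
    _ = ((1 - F₁)⁻¹)ᵀ * ((1 - F₁)ᵀ * E * (1 - F₂)) * (1 - F₂)⁻¹ := by noncomm_ring
    _ = _ := by rw [key, Matrix.transpose_mul]; noncomm_ring

/-- The Cayley identity reduces to `E = S₁ᵀ E S₂`; iterating it, the powers drive the right side to
`0`. -/
theorem eq_zero_of_sylvester (h₁ : IsStableMatrix F₁) (h₂ : IsStableMatrix F₂)
    {E : Matrix (Fin n) (Fin n) ℝ} (hE : F₁ᵀ * E + E * F₂ = 0) : E = 0 := by
  have h := cayley_identity h₁ h₂ E
  have t₁ := h₁.tendsto_cayley_pow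
  have t₂ := h₂.tendsto_cayley_pow
  set S₁ := (1 + F₁) * (1 - F₁)⁻¹
  set S₂ := (1 + F₂) * (1 - F₂)⁻¹
  rw [hE, Matrix.mul_zero, Matrix.zero_mul, smul_zero, sub_zero] at h
  have hk : ∀ k : ℕ, (S₁ ^ k)ᵀ * E * S₂ ^ k = E := by
    intro k
    induction k with
    | zero => simp
    | succ k ih =>
      calc _ = (S₁ ^ k)ᵀ * (S₁ᵀ * E * S₂) * S₂ ^ k := by
            rw [pow_succ' S₁, pow_succ' S₂, Matrix.transpose_mul]
            simp only [Matrix.mul_assoc]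
        _ = E := by rw [← h, ih]
  have c : Continuous fun p : Matrix (Fin n) (Fin n) ℝ × Matrix (Fin n) (Fin n) ℝ =>
    p.1ᵀ * E * p.2 := by fun_prop
  have t := (c.tendsto (0, 0)).comp (t₁.prodMk_nhds t₂)
  simp only [Function.comp_def, hk, Matrix.mul_zero] at t
  exact tendsto_nhds_unique tendsto_const_nhds t

/-- The form of `X` does not increase along the iterates `S ^ k v`, which tend to `0`, so its
initial value is at least `0`. Symmetry comes from uniqueness, since `Xᵀ` solves the same equation.
-/
theorem posSemidef_of_lyapunov (hF : IsStableMatrix F) {X M : Matrix (Fin n) (Fin n) ℝ}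
    (hM : M.PosSemidef) (hX : Fᵀ * X + X * F + M = 0) : X.PosSemidef := by
  have hsymm : Xᵀ = X := by
    rw [← sub_eq_zero]
    apply eq_zero_of_sylvester hF hF
    have hMs := (posSemidef_real_iff.1 hM).1
    have h2 := congrArg Matrix.transpose hX
    simp only [Matrix.transpose_add, Matrix.transpose_mul, Matrix.transpose_transpose, hMs,
      Matrix.transpose_zero] at h2
    have : Fᵀ * (Xᵀ - X) + (Xᵀ - X) * F =
      (Xᵀ * F + Fᵀ * Xᵀ + M) - (Fᵀ * X + X * F + M) := by noncomm_ring
    rw [this, h2, hX, sub_zero]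
  have h := cayley_identity hF hF X
  have t := hF.tendsto_cayley_pow
  set S := (1 + F) * (1 - F)⁻¹
  set N := (1 - F)⁻¹
  have hFX : Fᵀ * X + X * F = -M := eq_neg_of_add_eq_zero_left hX
  have hstep : ∀ v : Fin n → ℝ, (S *ᵥ v) ⬝ᵥ X *ᵥ (S *ᵥ v) ≤ v ⬝ᵥ X *ᵥ v := by
    intro v
    have h1 : v ⬝ᵥ X *ᵥ v = (S *ᵥ v) ⬝ᵥ X *ᵥ (S *ᵥ v) + 2 * ((N *ᵥ v) ⬝ᵥ M *ᵥ (N *ᵥ v)) := by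
      conv_lhs => rw [h, hFX]
      rw [Matrix.sub_mulVec, dotProduct_sub, dotProduct_transpose_mul_mul_mulVec, two_smul,
        Matrix.add_mulVec, dotProduct_add, dotProduct_transpose_mul_mul_mulVec,
        Matrix.neg_mulVec, dotProduct_neg]
      ring
    have h2 := (posSemidef_real_iff.1 hM).2 (N *ᵥ v)
    linarith
  refine posSemidef_real_iff.2 ⟨hsymm, fun v => ?_⟩
  have hk : ∀ k : ℕ, (S ^ k *ᵥ v) ⬝ᵥ X *ᵥ (S ^ k *ᵥ v) ≤ v ⬝ᵥ X *ᵥ v := by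
    intro k
    induction k with
    | zero => simp
    | succ k ih =>
      rw [pow_succ', ← Matrix.mulVec_mulVec]
      exact (hstep _).trans ih
  have c : Continuous fun T : Matrix (Fin n) (Fin n) ℝ => (T *ᵥ v) ⬝ᵥ X *ᵥ (T *ᵥ v) := by
    fun_prop
  have t' := (c.tendsto 0).comp t
  simp only [Matrix.zero_mulVec, zero_dotProduct] at t'
  exact le_of_tendsto' t' hk

theorem exists_lyapunov (hF : IsStableMatrix F) (M : Matrix (Fin n) (Fin n) ℝ) :
    ∃ X, Fᵀ * X + X * F + M = 0 := by
  let T : Matrix (Fin n) (Fin n) ℝ →ₗ[ℝ] Matrix (Fin n) (Fin n) ℝ :=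
    LinearMap.mulLeft ℝ Fᵀ + LinearMap.mulRight ℝ F
  have hT : ∀ X, T X = Fᵀ * X + X * F := fun X => rfl
  have hinj : Function.Injective T := by
    rw [← LinearMap.ker_eq_bot, LinearMap.ker_eq_bot']
    intro X hX
    exact eq_zero_of_sylvester hF hF hX
  obtain ⟨X, hX⟩ := LinearMap.injective_iff_surjective.1 hinj (-M)
  exact ⟨X, by rw [← hT, hX, neg_add_cancel]⟩

theorem mem_spectrum_shift {c : ℝ} {μ : ℂ}
    (h : μ ∈ spectrum ℂ ((F + c • (1 : Matrix _ _ ℝ)).map (algebraMap ℝ ℂ))) :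
    μ - c ∈ spectrum ℂ (F.map (algebraMap ℝ ℂ)) := by
  obtain ⟨a, b, hab, h1, h2⟩ := mem_spectrum_map_iff_exists_real.1 h
  refine mem_spectrum_map_iff_exists_real.2 ⟨a, b, hab, ?_, ?_⟩
  · rw [Matrix.add_mulVec, Matrix.smul_mulVec, Matrix.one_mulVec] at h1
    simp only [Complex.sub_re, Complex.ofReal_re, Complex.sub_im, Complex.ofReal_im, sub_zero,
      sub_smul]
    rw [eq_sub_of_add_eq h1]
    abel
  · rw [Matrix.add_mulVec, Matrix.smul_mulVec, Matrix.one_mulVec] at h2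
    simp only [Complex.sub_re, Complex.ofReal_re, Complex.sub_im, Complex.ofReal_im, sub_zero,
      sub_smul]
    rw [eq_sub_of_add_eq h2]
    abel

/-- The spectrum is finite, so it keeps a positive distance from the imaginary axis. -/
theorem exists_shift (hF : IsStableMatrix F) :
    ∃ δ : ℝ, 0 < δ ∧ ∀ c < δ, IsStableMatrix (F + c • (1 : Matrix (Fin n) (Fin n) ℝ)) := by
  have hfin := Matrix.finite_spectrum (F.map (algebraMap ℝ ℂ))
  have : ∃ δ : ℝ, 0 < δ ∧ ∀ μ ∈ spectrum ℂ (F.map (algebraMap ℝ ℂ)), μ.re ≤ -δ := by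
    rcases (spectrum ℂ (F.map (algebraMap ℝ ℂ))).eq_empty_or_nonempty with he | hne
    · exact ⟨1, one_pos, fun μ hμ => by rw [he] at hμ; exact hμ.elim⟩
    · obtain ⟨ν, hν, hmax⟩ := Set.exists_max_image _ Complex.re hfin hne
      exact ⟨-ν.re, by simpa using hF ν hν, fun μ hμ => by simpa using hmax μ hμ⟩
  obtain ⟨δ, hδ, h⟩ := this
  refine ⟨δ, hδ, fun c hc μ hμ => ?_⟩
  have := h _ (mem_spectrum_shift hμ)
  simp at this
  linarith

end IsStableMatrix

/-! ### Observability in terms of invariant subspaces -/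

/-- No nonzero `A`-invariant subspace lies in the kernel of `C`. -/
def HasNoHiddenSubspace {n k : ℕ} (C : Matrix (Fin k) (Fin n) ℝ) (A : Matrix (Fin n) (Fin n) ℝ) :
    Prop :=
  ∀ W : Submodule ℝ (Fin n → ℝ), (∀ v ∈ W, A *ᵥ v ∈ W) → (∀ v ∈ W, C *ᵥ v = 0) → W = ⊥

section
attribute [local instance] Matrix.linftyOpNormedRing Matrix.linftyOpNormedAlgebra

/-- For `v` in such a subspace, the trajectory `exp (tA) v` has zero output, because every term `C
A^j v` of the series vanishes. -/
theorem IsObservable.hasNoHiddenSubspace {n k : ℕ} {C : Matrix (Fin k) (Fin n) ℝ}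
    {A : Matrix (Fin n) (Fin n) ℝ} (h : IsObservable C A) : HasNoHiddenSubspace C A := by
  intro W hA hC
  rw [Submodule.eq_bot_iff]
  intro v hv
  have : CompleteSpace (Matrix (Fin n) (Fin n) ℝ) := FiniteDimensional.complete ℝ _
  let ev : Matrix (Fin n) (Fin n) ℝ →L[ℝ] (Fin n → ℝ) :=
    LinearMap.toContinuousLinearMap ((Matrix.mulVecBilin ℝ ℝ).flip v)
  have hev : ∀ M, ev M = M *ᵥ v := fun M => rfl
  have hpow : ∀ j : ℕ, A ^ j *ᵥ v ∈ W := by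
    intro j
    induction j with
    | zero => simpa using hv
    | succ j ih => rw [pow_succ', ← Matrix.mulVec_mulVec]; exact hA _ ih
  have key := h (fun t => ev (NormedSpace.exp (t • A))) (fun t => ?_) (fun t _ => ?_)
  · simpa [hev] using key
  · have hd := ev.hasFDerivAt.comp_hasDerivAt t (hasDerivAt_exp_smul_const' (𝕂 := ℝ) A t)
    have e : A *ᵥ ev (NormedSpace.exp (t • A)) = ev (A * NormedSpace.exp (t • A)) := by
      rw [hev, hev, Matrix.mulVec_mulVec]
    change HasDerivAt _ (A *ᵥ ev (NormedSpace.exp (t • A))) t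
    rw [e]
    exact hd
  · let evC : Matrix (Fin n) (Fin n) ℝ →L[ℝ] (Fin k → ℝ) :=
      (LinearMap.toContinuousLinearMap C.mulVecLin).comp ev
    have hevC : ∀ M, evC M = C *ᵥ (M *ᵥ v) := fun M => rfl
    have hs := (NormedSpace.exp_series_hasSum_exp' (𝕂 := ℝ) (t • A)).mapL evC
    rw [hev, ← hevC]
    refine hs.unique ?_
    convert hasSum_zero with j
    rw [map_smul, smul_pow, map_smul, hevC, hC _ (hpow j), smul_zero, smul_zero]

end

theorem HasNoHiddenSubspace.shift {n k : ℕ} {C : Matrix (Fin k) (Fin n) ℝ}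
    {A : Matrix (Fin n) (Fin n) ℝ} (h : HasNoHiddenSubspace C A) (c : ℝ) :
    HasNoHiddenSubspace C (A + c • (1 : Matrix (Fin n) (Fin n) ℝ)) := by
  intro W hA hC
  refine h W (fun v hv => ?_) hC
  have h1 := W.sub_mem (hA v hv) (W.smul_mem c hv)
  rwa [Matrix.add_mulVec, Matrix.smul_mulVec, Matrix.one_mulVec, add_sub_cancel_right] at h1

theorem Matrix.PosSemidef.mulVec_eq_zero {n : ℕ} {X : Matrix (Fin n) (Fin n) ℝ}
    (hX : X.PosSemidef) {v : Fin n → ℝ} (hv : v ⬝ᵥ X *ᵥ v = 0) : X *ᵥ v = 0 := by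
  exact (hX.dotProduct_mulVec_zero_iff v).1 (by simpa using hv)

theorem dotProduct_transpose_mul_self {n k : ℕ} (C : Matrix (Fin k) (Fin n) ℝ) (v : Fin n → ℝ) :
    v ⬝ᵥ (Cᵀ * C) *ᵥ v = (C *ᵥ v) ⬝ᵥ (C *ᵥ v) := by
  rw [← Matrix.mulVec_mulVec, Matrix.dotProduct_mulVec, Matrix.vecMul_transpose]

theorem dotProduct_self_nonneg_real {k : ℕ} (v : Fin k → ℝ) : 0 ≤ v ⬝ᵥ v :=
  Finset.sum_nonneg fun _ _ => mul_self_nonneg _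

theorem dotProduct_mulVec_comm_of_symm {n : ℕ} {X : Matrix (Fin n) (Fin n) ℝ} (hX : Xᵀ = X)
    (v w : Fin n → ℝ) : v ⬝ᵥ X *ᵥ w = w ⬝ᵥ X *ᵥ v := by
  rw [Matrix.dotProduct_mulVec, dotProduct_comm, ← Matrix.mulVec_transpose, hX]

theorem dotProduct_symm_mul_mul_mulVec {n : ℕ} {X : Matrix (Fin n) (Fin n) ℝ} (hX : Xᵀ = X)
    (G : Matrix (Fin n) (Fin n) ℝ) (v : Fin n → ℝ) :
    v ⬝ᵥ (X * G * X) *ᵥ v = (X *ᵥ v) ⬝ᵥ G *ᵥ (X *ᵥ v) := by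
  nth_rewrite 1 [← hX]
  exact dotProduct_transpose_mul_mul_mulVec X G X v v

/-- An eigenvalue with nonnegative real part forces the source term of a Lyapunov equation with
positive semidefinite solution to vanish on the eigenvector. -/
theorem lyapunov_source_eq_zero {n : ℕ} {F X N : Matrix (Fin n) (Fin n) ℝ} (hX : X.PosSemidef)
    (hN : ∀ v, 0 ≤ v ⬝ᵥ N *ᵥ v) (h : Fᵀ * X + X * F + N = 0) {σ ω : ℝ} (hσ : 0 ≤ σ)
    {a b : Fin n → ℝ} (ha : F *ᵥ a = σ • a - ω • b) (hb : F *ᵥ b = ω • a + σ • b) :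
    a ⬝ᵥ N *ᵥ a = 0 ∧ b ⬝ᵥ N *ᵥ b = 0 := by
  obtain ⟨hs, hq⟩ := posSemidef_real_iff.1 hX
  have hv : ∀ v, 2 * (v ⬝ᵥ X *ᵥ (F *ᵥ v)) + v ⬝ᵥ N *ᵥ v = 0 := by
    intro v
    have h1 := congrArg (fun M => v ⬝ᵥ M *ᵥ v) h
    simp only [Matrix.add_mulVec, dotProduct_add, Matrix.zero_mulVec, dotProduct_zero,
      ← Matrix.mulVec_mulVec] at h1
    rw [Matrix.dotProduct_mulVec v Fᵀ, Matrix.vecMul_transpose,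
      dotProduct_mulVec_comm_of_symm hs] at h1
    linarith
  have h1 := hv a
  have h2 := hv b
  rw [ha] at h1
  rw [hb] at h2
  simp only [Matrix.mulVec_sub, Matrix.mulVec_add, Matrix.mulVec_smul, dotProduct_sub,
    dotProduct_add, dotProduct_smul, smul_eq_mul] at h1 h2
  -- After this the `ω` cross terms cancel in `h1 + h2`, leaving a sum of nonnegative terms equal to
  -- zero.
  rw [dotProduct_mulVec_comm_of_symm hs b a] at h2
  have := mul_nonneg hσ (hq a)
  have := mul_nonneg hσ (hq b)
  have := hN a
  have := hN b
  constructor <;> linarith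

/-! ### Riccati equations: stabilization, definiteness, comparison -/

/-- Positive semidefinite solutions of `XA + AᵀX - XGX + H = 0`. -/
def IsPSDARESol {n : ℕ} (A G H X : Matrix (Fin n) (Fin n) ℝ) : Prop :=
  X.PosSemidef ∧ X * A + Aᵀ * X - X * G * X + H = 0

namespace IsPSDARESol

variable {n k : ℕ} {A G X Y : Matrix (Fin n) (Fin n) ℝ} {C : Matrix (Fin k) (Fin n) ℝ}

theorem closed_loop_lyapunov {H : Matrix (Fin n) (Fin n) ℝ} (hG : G.PosSemidef)
    (hX : IsPSDARESol A G H X) :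
    (A - G * X)ᵀ * X + X * (A - G * X) + (X * G * X + H) = 0 := by
  have hs := (posSemidef_real_iff.1 hX.1).1
  have hGs := (posSemidef_real_iff.1 hG).1
  rw [← hX.2, Matrix.transpose_sub, Matrix.transpose_mul, hs, hGs]
  noncomm_ring

/-- An eigenvector `a + ib` with eigenvalue in the closed right half-plane makes the Lyapunov source
vanish at `a` and `b`. The feedback and the output are then zero there, so the span of `a` and `b`
is `A`-invariant and unobservable. -/
theorem isStableMatrix (hG : G.PosSemidef) (hC : HasNoHiddenSubspace C A)
    (hX : IsPSDARESol A G (Cᵀ * C) X) : IsStableMatrix (A - G * X) := by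
  intro μ hμ
  by_contra! hre
  obtain ⟨a, b, hab, ha, hb⟩ := mem_spectrum_map_iff_exists_real.1 hμ
  have hs := (posSemidef_real_iff.1 hX.1).1
  have hGq := (posSemidef_real_iff.1 hG).2
  have hsplit : ∀ v : Fin n → ℝ, v ⬝ᵥ (X * G * X + Cᵀ * C) *ᵥ v =
      (X *ᵥ v) ⬝ᵥ G *ᵥ (X *ᵥ v) + (C *ᵥ v) ⬝ᵥ (C *ᵥ v) := fun v => by
    rw [Matrix.add_mulVec, dotProduct_add, dotProduct_symm_mul_mul_mulVec hs,
      dotProduct_transpose_mul_self]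
  have hkill : ∀ v : Fin n → ℝ, v ⬝ᵥ (X * G * X + Cᵀ * C) *ᵥ v = 0 →
      (A - G * X) *ᵥ v = A *ᵥ v ∧ C *ᵥ v = 0 := fun v hv => by
    rw [hsplit] at hv
    have h1 := hGq (X *ᵥ v)
    have h2 := dotProduct_self_nonneg_real (C *ᵥ v)
    refine ⟨?_, dotProduct_self_eq_zero.1 (by linarith)⟩
    rw [Matrix.sub_mulVec, ← Matrix.mulVec_mulVec, hG.mulVec_eq_zero (by linarith), sub_zero]
  obtain ⟨h1, h2⟩ := lyapunov_source_eq_zero hX.1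
    (fun v => by
      rw [hsplit]; exact add_nonneg (hGq _) (dotProduct_self_nonneg_real _))
    (closed_loop_lyapunov hG hX) hre ha hb
  obtain ⟨ha1, ha2⟩ := hkill a h1
  obtain ⟨hb1, hb2⟩ := hkill b h2
  rw [ha1] at ha
  rw [hb1] at hb
  have hbot := hC (Submodule.span ℝ {a, b}) (fun v hv => by
      obtain ⟨x, y, rfl⟩ := Submodule.mem_span_pair.1 hv
      refine Submodule.mem_span_pair.2 ⟨x * μ.re + y * μ.im, y * μ.re - x * μ.im, ?_⟩
      rw [Matrix.mulVec_add, Matrix.mulVec_smul, Matrix.mulVec_smul, ha, hb]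
      module) (fun v hv => by
      obtain ⟨x, y, rfl⟩ := Submodule.mem_span_pair.1 hv
      rw [Matrix.mulVec_add, Matrix.mulVec_smul, Matrix.mulVec_smul, ha2, hb2]
      simp)
  rw [Submodule.span_eq_bot] at hbot
  rcases hab with h | h
  · exact h (hbot a (by simp))
  · exact h (hbot b (by simp))

/-- The equation itself shows that the kernel of `X` is `A`-invariant and contained in that of `C`.
-/
theorem posDef (hC : HasNoHiddenSubspace C A) (hX : IsPSDARESol A G (Cᵀ * C) X) : X.PosDef := by
  have hs := (posSemidef_real_iff.1 hX.1).1
  have hker : ∀ v, X *ᵥ v = 0 → C *ᵥ v = 0 ∧ X *ᵥ (A *ᵥ v) = 0 := by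
    intro v hv
    have h := congrArg (fun M => M *ᵥ v) hX.2
    simp only [Matrix.add_mulVec, Matrix.sub_mulVec, ← Matrix.mulVec_mulVec, hv,
      Matrix.mulVec_zero, Matrix.zero_mulVec, add_zero, sub_zero] at h
    have h2 := congrArg (fun w => v ⬝ᵥ w) h
    simp only [dotProduct_add, dotProduct_zero] at h2
    rw [dotProduct_mulVec_comm_of_symm hs, hv, dotProduct_zero, zero_add,
      Matrix.mulVec_mulVec, dotProduct_transpose_mul_self] at h2
    have h3 : C *ᵥ v = 0 := dotProduct_self_eq_zero.1 h2
    refine ⟨h3, ?_⟩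
    rwa [h3, Matrix.mulVec_zero, add_zero] at h
  have hbot := hC (LinearMap.ker X.mulVecLin) (fun v hv => (hker v hv).2) (fun v hv => (hker v hv).1)
  refine Matrix.PosDef.of_dotProduct_mulVec_pos hX.1.1 fun v hv => ?_
  have h0 := (posSemidef_real_iff.1 hX.1).2 v
  rw [star_trivial]
  refine lt_of_le_of_ne h0 fun h => hv ?_
  have : v ∈ LinearMap.ker X.mulVecLin := hX.1.mulVec_eq_zero h.symm
  rw [hbot] at this
  exact this

/-- Solutions are monotone in the shift of the drift matrix. -/
theorem sub_posSemidef {c d : ℝ} (hdc : d ≤ c) (hG : G.PosSemidef) (hC : HasNoHiddenSubspace C A)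
    (hX : IsPSDARESol (A + c • (1 : Matrix (Fin n) (Fin n) ℝ)) G (Cᵀ * C) X)
    (hY : IsPSDARESol (A + d • (1 : Matrix (Fin n) (Fin n) ℝ)) G (Cᵀ * C) Y) :
    (X - Y).PosSemidef := by
  have hst := isStableMatrix hG (hC.shift c) hX
  have hsX := (posSemidef_real_iff.1 hX.1).1
  have hsY := (posSemidef_real_iff.1 hY.1).1
  have hGs := (posSemidef_real_iff.1 hG).1
  have hst' : IsStableMatrix (A + d • (1 : Matrix (Fin n) (Fin n) ℝ) - G * X) := by
    obtain ⟨δ, hδ, h⟩ := hst.exists_shift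
    have := h (d - c) (by linarith)
    convert this using 1
    rw [sub_smul]
    abel
  -- This is the source in the Lyapunov equation for `X - Y` with coefficient `A + d I - G X`, found
  -- by subtracting the two Riccati equations and completing the square.
  have hM : ((2 * (c - d)) • X + (X - Y)ᵀ * G * (X - Y)).PosSemidef := by
    refine (hX.1.smul (by linarith)).add ?_
    simpa using hG.conjTranspose_mul_mul_same (X - Y)
  refine hst'.posSemidef_of_lyapunov hM ?_
  have e1 := hX.2
  have e2 := hY.2
  rw [← sub_self (0 : Matrix (Fin n) (Fin n) ℝ)]
  conv_rhs => 
    congr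
    · rw [← e1]
    · rw [← e2]
  simp only [Matrix.transpose_sub, Matrix.transpose_add, Matrix.transpose_mul,
    Matrix.transpose_smul, Matrix.transpose_one, hsX, hsY, hGs, Matrix.add_mul, Matrix.mul_add,
    Matrix.sub_mul, Matrix.mul_sub, smul_mul_assoc, mul_smul_comm, Matrix.one_mul, Matrix.mul_one,
    ← Matrix.mul_assoc]
  module

theorem unique {c : ℝ} (hG : G.PosSemidef) (hC : HasNoHiddenSubspace C A)
    (hX : IsPSDARESol (A + c • (1 : Matrix (Fin n) (Fin n) ℝ)) G (Cᵀ * C) X)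
    (hY : IsPSDARESol (A + c • (1 : Matrix (Fin n) (Fin n) ℝ)) G (Cᵀ * C) Y) : X = Y := by
  open scoped MatrixOrder in
  exact le_antisymm (Matrix.le_iff.2 (sub_posSemidef le_rfl hG hC hY hX))
    (Matrix.le_iff.2 (sub_posSemidef le_rfl hG hC hX hY))

end IsPSDARESol

/-! ### Order bounds and monotone limits of semidefinite matrices -/

theorem isClosed_setOf_posSemidef_real {n : ℕ} :
    IsClosed {M : Matrix (Fin n) (Fin n) ℝ | M.PosSemidef} := by
  simp only [posSemidef_real_iff, Set.ofPred_and, Set.ofPred_forall]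
  refine (isClosed_eq (by fun_prop) (by fun_prop)).inter (isClosed_iInter fun x => ?_)
  exact isClosed_le (by fun_prop) (by fun_prop)

theorem Matrix.PosSemidef.abs_apply_le {n : ℕ} {M N : Matrix (Fin n) (Fin n) ℝ}
    (hM : M.PosSemidef) (hN : (N - M).PosSemidef) (i j : Fin n) : |M i j| ≤ N i i + N j j := by
  obtain ⟨hs, hq⟩ := posSemidef_real_iff.1 hM
  have hji : M j i = M i j := congrFun (congrFun hs i) j
  have h1 := hq (Pi.single i 1 + Pi.single j 1)
  have h2 := hq (Pi.single i 1 - Pi.single j 1)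
  have h3 : 0 ≤ (N - M) i i := hN.diag_nonneg
  have h4 : 0 ≤ (N - M) j j := hN.diag_nonneg
  have h5 : 0 ≤ M i i := hM.diag_nonneg
  have h6 : 0 ≤ M j j := hM.diag_nonneg
  simp [Matrix.mulVec_add, Matrix.mulVec_sub, hji] at h1 h2 h3 h4
  rw [abs_le]
  constructor <;> linarith

/-- Each quadratic form is decreasing and bounded below; polarization recovers the entries. -/
theorem exists_tendsto_of_antitone_posSemidef {n : ℕ} {X : ℕ → Matrix (Fin n) (Fin n) ℝ}
    (hX : ∀ k, (X k).PosSemidef) (hanti : ∀ k, (X k - X (k + 1)).PosSemidef) :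
    ∃ L, Tendsto X atTop (𝓝 L) := by
  have hq : ∀ v : Fin n → ℝ, ∃ q, Tendsto (fun k => v ⬝ᵥ X k *ᵥ v) atTop (𝓝 q) := by
    intro v
    refine ⟨_, tendsto_atTop_ciInf (antitone_nat_of_succ_le fun k => ?_)
      ⟨0, by rintro _ ⟨k, rfl⟩; exact (posSemidef_real_iff.1 (hX k)).2 v⟩⟩
    have := (posSemidef_real_iff.1 (hanti k)).2 v
    rw [Matrix.sub_mulVec, dotProduct_sub] at this
    linarith
  choose q hq using hq
  refine ⟨Matrix.of fun i j => (q (Pi.single i 1 + Pi.single j 1) - q (Pi.single i 1) -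
    q (Pi.single j 1)) / 2, tendsto_matrix_iff.2 fun i j => ?_⟩
  have h := (((hq (Pi.single i 1 + Pi.single j 1)).sub (hq (Pi.single i 1))).sub
    (hq (Pi.single j 1))).div_const 2
  refine h.congr fun k => ?_
  have hji : X k j i = X k i j := congrFun (congrFun (posSemidef_real_iff.1 (hX k)).1 i) j
  simp [Matrix.mulVec_add, hji]
  ring

/-! ### Existence by Newton-Kleinman iteration -/

/-- The value matrix of a stabilizing static state feedback. -/
def IsFeedbackValue {n m : ℕ} (A : Matrix (Fin n) (Fin n) ℝ) (B : Matrix (Fin n) (Fin m) ℝ)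
    (R : Matrix (Fin m) (Fin m) ℝ) (H X : Matrix (Fin n) (Fin n) ℝ) : Prop :=
  X.PosSemidef ∧ ∃ K : Matrix (Fin m) (Fin n) ℝ, IsStableMatrix (A + B * K) ∧
    (A + B * K)ᵀ * X + X * (A + B * K) + (Kᵀ * R * K + H) = 0

theorem IsStabilizable.exists_isFeedbackValue {n m : ℕ} {A : Matrix (Fin n) (Fin n) ℝ}
    {B : Matrix (Fin n) (Fin m) ℝ} (h : IsStabilizable A B) {R : Matrix (Fin m) (Fin m) ℝ}
    {H : Matrix (Fin n) (Fin n) ℝ} (hR : R.PosDef) (hH : H.PosSemidef) :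
    ∃ X, IsFeedbackValue A B R H X := by
  obtain ⟨K, hK⟩ := h
  obtain ⟨X, hX⟩ := hK.exists_lyapunov (Kᵀ * R * K + H)
  refine ⟨X, hK.posSemidef_of_lyapunov (.add ?_ hH) hX, K, hK, hX⟩
  simpa using hR.posSemidef.conjTranspose_mul_mul_same K

/-- One step of the Newton-Kleinman iteration. -/
theorem IsFeedbackValue.exists_next {n m : ℕ} {A : Matrix (Fin n) (Fin n) ℝ}
    {B : Matrix (Fin n) (Fin m) ℝ} {R : Matrix (Fin m) (Fin m) ℝ}
    {H X : Matrix (Fin n) (Fin n) ℝ} (hR : R.PosDef) (hH : H.PosSemidef)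
    (h : IsFeedbackValue A B R H X) :
    ∃ Y, IsFeedbackValue A B R H Y ∧ (X - Y).PosSemidef ∧
      (A - B * R⁻¹ * Bᵀ * X)ᵀ * Y + Y * (A - B * R⁻¹ * Bᵀ * X) +
        (X * (B * R⁻¹ * Bᵀ) * X + H) = 0 := by
  obtain ⟨hX, K, hK, hL⟩ := h
  have hs := (posSemidef_real_iff.1 hX).1
  have hRis := (posSemidef_real_iff.1 hR.inv.posSemidef).1
  have hdet : IsUnit R.det := (Matrix.isUnit_iff_isUnit_det _).1 hR.isUnit
  -- `T` is the gap between the current gain and the improved gain `-R⁻¹ Bᵀ X`. Completing the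
  -- square rewrites the equation for `X` along the improved loop `F`, with extra source `Tᵀ R T`.
  set T := K + R⁻¹ * Bᵀ * X with hT
  set F := A - B * R⁻¹ * Bᵀ * X with hF
  have hFK : A + B * K = F + B * T := by 
    simp only [hF, hT, Matrix.mul_add, Matrix.mul_assoc]
    abel
  have hGs : (X * (B * R⁻¹ * Bᵀ) * X).PosSemidef := by
    have e : X * (B * R⁻¹ * Bᵀ) * X = (Bᵀ * X)ᵀ * R⁻¹ * (Bᵀ * X) := by
      simp only [Matrix.transpose_mul, Matrix.transpose_transpose, hs, Matrix.mul_assoc]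
    rw [e, ← Matrix.conjTranspose_eq_transpose_of_trivial]
    exact hR.inv.posSemidef.conjTranspose_mul_mul_same (Bᵀ * X)
  have hTR : (Tᵀ * R * T).PosSemidef := by simpa using hR.posSemidef.conjTranspose_mul_mul_same T
  have hN := (hGs.add hH).add hTR
  have hRT : R * T = R * K + Bᵀ * X := by
    rw [hT, Matrix.mul_add, Matrix.mul_assoc, ← Matrix.mul_assoc R, Matrix.mul_nonsing_inv _ hdet,
      Matrix.one_mul]
  have hTt : Tᵀ = Kᵀ + X * B * R⁻¹ := by
    
    rw [hT, Matrix.transpose_add, Matrix.transpose_mul, Matrix.transpose_mul, hs, hRis,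
      Matrix.transpose_transpose, Matrix.mul_assoc]
  have hLF : Fᵀ * X + X * F + (X * (B * R⁻¹ * Bᵀ) * X + H + Tᵀ * R * T) = 0 := by
    have e1 : Tᵀ * R * T = Kᵀ * R * K + Kᵀ * Bᵀ * X + X * B * T := by
      rw [Matrix.mul_assoc, hRT, hTt, hT]
      have : X * B * R⁻¹ * (R * K) = X * B * K := by
        rw [Matrix.mul_assoc, ← Matrix.mul_assoc R⁻¹, Matrix.nonsing_inv_mul _ hdet,
          Matrix.one_mul]
      rw [Matrix.add_mul, Matrix.mul_add, Matrix.mul_add, this]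
      simp only [Matrix.mul_add, Matrix.mul_assoc]
    have e2 : (A + B * K)ᵀ = Fᵀ + X * B * R⁻¹ * Bᵀ + Kᵀ * Bᵀ := by
      rw [hF]
      simp only [Matrix.transpose_add, Matrix.transpose_sub, Matrix.transpose_mul, hs, hRis,
        Matrix.transpose_transpose, Matrix.mul_assoc, sub_add_cancel]
    rw [← hL, e1, e2, hFK]
    simp only [Matrix.mul_add, Matrix.add_mul, Matrix.mul_assoc]
    abel
  -- A bad eigenvector of `F` is annihilated by `T`, so it is also a bad eigenvector of the stable
  -- loop `A + B K`.
  have hst : IsStableMatrix F := by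
    intro μ hμ
    by_contra! hre
    obtain ⟨a, b, hab, ha, hb⟩ := mem_spectrum_map_iff_exists_real.1 hμ
    obtain ⟨h1, h2⟩ := lyapunov_source_eq_zero hX (posSemidef_real_iff.1 hN).2 hLF hre ha hb
    have hkill : ∀ v : Fin n → ℝ,
        v ⬝ᵥ (X * (B * R⁻¹ * Bᵀ) * X + H + Tᵀ * R * T) *ᵥ v = 0 → (A + B * K) *ᵥ v = F *ᵥ v := by
      intro v hv
      rw [Matrix.add_mulVec, dotProduct_add, dotProduct_transpose_mul_mul_mulVec] at hv
      have p1 := (posSemidef_real_iff.1 (hGs.add hH)).2 v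
      have p2 := (posSemidef_real_iff.1 hR.posSemidef).2 (T *ᵥ v)
      have p3 : T *ᵥ v = 0 := by
        by_contra hne
        have := hR.dotProduct_mulVec_pos hne
        rw [star_trivial] at this
        linarith
      rw [hFK, Matrix.add_mulVec, ← Matrix.mulVec_mulVec, p3, Matrix.mulVec_zero, add_zero]
    exact absurd (hK μ (mem_spectrum_map_iff_exists_real.2
      ⟨a, b, hab, by rw [hkill a h1, ha], by rw [hkill b h2, hb]⟩)) hre.not_gt
  obtain ⟨Y, hY⟩ := hst.exists_lyapunov (X * (B * R⁻¹ * Bᵀ) * X + H)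
  refine ⟨Y, ⟨hst.posSemidef_of_lyapunov (hGs.add hH) hY, -(R⁻¹ * Bᵀ * X), ?_, ?_⟩, ?_, hY⟩
  · convert hst using 1
    simp only [hF, Matrix.mul_neg, Matrix.mul_assoc, sub_eq_add_neg]
  · have e1 : A + B * -(R⁻¹ * Bᵀ * X) = F := by
      simp only [hF, Matrix.mul_neg, Matrix.mul_assoc, sub_eq_add_neg]
    have e2 : (-(R⁻¹ * Bᵀ * X))ᵀ * R * -(R⁻¹ * Bᵀ * X) = X * (B * R⁻¹ * Bᵀ) * X := by
      have : (R⁻¹ * Bᵀ * X)ᵀ * R = X * B := by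
        rw [Matrix.transpose_mul, Matrix.transpose_mul, hs, hRis, Matrix.transpose_transpose,
          Matrix.mul_assoc, Matrix.mul_assoc, Matrix.nonsing_inv_mul _ hdet, Matrix.mul_one]
      rw [Matrix.transpose_neg, Matrix.neg_mul, Matrix.neg_mul, Matrix.mul_neg, neg_neg, this]
      simp only [Matrix.mul_assoc]
    rw [e1, e2, hY]
  -- Subtracting the equations of `X` and `Y` leaves exactly the source `Tᵀ R T`.
  · refine hst.posSemidef_of_lyapunov hTR ?_
    have e := congrArg₂ (· - ·) hLF hY
    simp only [sub_zero] at e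
    rw [← e, Matrix.mul_sub, Matrix.sub_mul]
    abel

/-- The iterates decrease, hence converge. In the limit consecutive iterates coincide, and the
Lyapunov recursion becomes the Riccati equation. -/
theorem IsStabilizable.exists_isPSDARESol {n m : ℕ} {A : Matrix (Fin n) (Fin n) ℝ}
    {B : Matrix (Fin n) (Fin m) ℝ} (h : IsStabilizable A B) {R : Matrix (Fin m) (Fin m) ℝ}
    {H : Matrix (Fin n) (Fin n) ℝ} (hR : R.PosDef) (hH : H.PosSemidef) :
    ∃ X, IsPSDARESol A (B * R⁻¹ * Bᵀ) H X := by
  obtain ⟨X₀, hX₀⟩ := h.exists_isFeedbackValue hR hH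
  choose next hnext using fun X : {X // IsFeedbackValue A B R H X} => X.2.exists_next hR hH
  let S : ℕ → {X // IsFeedbackValue A B R H X} := fun k =>
    Nat.rec ⟨X₀, hX₀⟩ (fun _ X => ⟨next X, (hnext X).1⟩) k
  have hS : ∀ k, (S (k + 1)).1 = next (S k) := fun k => rfl
  obtain ⟨L, hL⟩ := exists_tendsto_of_antitone_posSemidef (X := fun k => (S k).1)
    (fun k => (S k).2.1) (fun k => by rw [hS]; exact (hnext (S k)).2.1)
  have hLp : L.PosSemidef :=
    isClosed_setOf_posSemidef_real.mem_of_tendsto hL (Eventually.of_forall fun k => (S k).2.1)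
  refine ⟨L, hLp, ?_⟩
  have hs := (posSemidef_real_iff.1 hLp).1
  have hRis := (posSemidef_real_iff.1 hR.inv.posSemidef).1
  set G := B * R⁻¹ * Bᵀ with hG
  have hGs : Gᵀ = G := by simp [hG, Matrix.transpose_mul, hRis, Matrix.mul_assoc]
  have c : Continuous fun p : Matrix (Fin n) (Fin n) ℝ × Matrix (Fin n) (Fin n) ℝ =>
    (A - G * p.1)ᵀ * p.2 + p.2 * (A - G * p.1) + (p.1 * G * p.1 + H) := by fun_prop
  have t := (c.tendsto (L, L)).comp (hL.prodMk_nhds (hL.comp (tendsto_add_atTop_nat 1)))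
  have hz : (A - G * L)ᵀ * L + L * (A - G * L) + (L * G * L + H) = 0 := by
    refine tendsto_nhds_unique t (tendsto_const_nhds.congr fun k => ?_)
    exact ((hnext (S k)).2.2).symm
  rw [← hz, Matrix.transpose_sub, Matrix.transpose_mul, hs, hGs]
  noncomm_ring

/-! ### Dependence on the shift, and rescaling -/

/-- Continuity of the Riccati solution along a filter, given an upper bound. -/
theorem IsPSDARESol.tendsto_of_bounded {n k : ℕ} {A G N L : Matrix (Fin n) (Fin n) ℝ}
    {C : Matrix (Fin k) (Fin n) ℝ} (hG : G.PosSemidef) (hC : HasNoHiddenSubspace C A)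
    {ι : Type*} {l : Filter ι} {c : ι → ℝ} {c₀ : ℝ} (hc : Tendsto c l (𝓝 c₀))
    {P : ι → Matrix (Fin n) (Fin n) ℝ}
    (hP : ∀ᶠ x in l, IsPSDARESol (A + c x • (1 : Matrix (Fin n) (Fin n) ℝ)) G (Cᵀ * C) (P x))
    (hN : ∀ᶠ x in l, (N - P x).PosSemidef)
    (hL : IsPSDARESol (A + c₀ • (1 : Matrix (Fin n) (Fin n) ℝ)) G (Cᵀ * C) L) :
    Tendsto P l (𝓝 L) := by
  have hcomp : IsCompact {M : Fin n → Fin n → ℝ |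
      ∀ i, M i ∈ {f : Fin n → ℝ | ∀ j, f j ∈ Set.Icc (-(N i i + N j j)) (N i i + N j j)}} :=
    isCompact_pi_infinite fun i => isCompact_pi_infinite fun j => isCompact_Icc
  refine IsCompact.tendsto_nhds_of_unique_mapClusterPt (X := Matrix (Fin n) (Fin n) ℝ) hcomp ?_ ?_
  · filter_upwards [hP, hN] with x hx hNx
    intro i j
    exact abs_le.1 (hx.1.abs_apply_le hNx i j)
  -- The equation passes to the limit along an ultrafilter, so by uniqueness every cluster point is
  -- `L`.
  · intro M _ hM
    obtain ⟨U, hU, hUM⟩ := mapClusterPt_iff_ultrafilter.1 hM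
    have hMp : M.PosSemidef := isClosed_setOf_posSemidef_real.mem_of_tendsto hUM
      (hU (hP.mono fun x hx => hx.1))
    refine IsPSDARESol.unique hG hC ⟨hMp, ?_⟩ hL
    have cont : Continuous fun p : ℝ × Matrix (Fin n) (Fin n) ℝ =>
      p.2 * (A + p.1 • (1 : Matrix (Fin n) (Fin n) ℝ)) +
        (A + p.1 • (1 : Matrix (Fin n) (Fin n) ℝ))ᵀ * p.2 - p.2 * G * p.2 + Cᵀ * C := by fun_prop
    have t := (cont.tendsto (c₀, M)).comp ((hc.mono_left hU).prodMk_nhds hUM)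
    refine tendsto_nhds_unique t (tendsto_const_nhds.congr' ?_)
    exact hU (hP.mono fun x hx => hx.2.symm)

theorem IsStabilizable.exists_shift {n m : ℕ} {A : Matrix (Fin n) (Fin n) ℝ}
    {B : Matrix (Fin n) (Fin m) ℝ} (h : IsStabilizable A B) :
    ∃ δ : ℝ, 0 < δ ∧ ∀ c < δ, IsStabilizable (A + c • (1 : Matrix (Fin n) (Fin n) ℝ)) B := by
  obtain ⟨K, hK⟩ := h
  obtain ⟨δ, hδ, h⟩ := hK.exists_shift
  refine ⟨δ, hδ, fun c hc => ⟨K, ?_⟩⟩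
  rw [add_right_comm]
  exact h c hc

theorem riccati_rescale {n : ℕ} (A G H X : Matrix (Fin n) (Fin n) ℝ) {α : ℝ} (hα : α ≠ 0) :
    (α • X) * (A + (α / 2) • (1 : Matrix (Fin n) (Fin n) ℝ)) +
      (A + (α / 2) • (1 : Matrix (Fin n) (Fin n) ℝ))ᵀ * (α • X) - (α • X) * G * (α • X) + H =
    α • (X * A + Aᵀ * X + α • X - α • (X * G * X) + (1 / α) • H) := by
  simp only [Matrix.transpose_add, Matrix.transpose_smul, Matrix.transpose_one, Matrix.mul_add,
    Matrix.add_mul, smul_mul_assoc, mul_smul_comm, Matrix.mul_one, Matrix.one_mul]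
  have hH : H = α • ((1 / α) • H) := by rw [smul_smul, mul_one_div_cancel hα, one_smul]
  conv_lhs => rw [hH]
  module

section
variable {n m k : ℕ} {A : Matrix (Fin n) (Fin n) ℝ} {B : Matrix (Fin n) (Fin m) ℝ}
  {C : Matrix (Fin k) (Fin n) ℝ} {D : Matrix (Fin k) (Fin m) ℝ} {α : ℝ}
  {X : Matrix (Fin n) (Fin n) ℝ}

theorem IsRiccatiSol.isPSDARESol (hα : 0 < α) (h : IsRiccatiSol A B C D α X) :
    IsPSDARESol (A + (α / 2) • (1 : Matrix (Fin n) (Fin n) ℝ)) (B * (Dᵀ * D)⁻¹ * Bᵀ) (Cᵀ * C)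
      (α • X) := by
  refine ⟨h.1.posSemidef.smul hα.le, ?_⟩
  have e := h.2
  rw [riccati_rescale _ _ _ _ hα.ne']
  simp only [Matrix.mul_assoc] at e ⊢
  rw [e, smul_zero]

theorem IsPSDARESol.isRiccatiSol (hα : 0 < α) (hC : HasNoHiddenSubspace C A)
    (h : IsPSDARESol (A + (α / 2) • (1 : Matrix (Fin n) (Fin n) ℝ)) (B * (Dᵀ * D)⁻¹ * Bᵀ)
      (Cᵀ * C) X) : IsRiccatiSol A B C D α (α⁻¹ • X) := by
  refine ⟨(h.posDef (hC.shift _)).smul (inv_pos.2 hα), ?_⟩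
  have e := h.2
  have hX : X = α • (α⁻¹ • X) := by rw [smul_smul, mul_inv_cancel₀ hα.ne', one_smul]
  rw [hX, riccati_rescale _ _ _ _ hα.ne', smul_eq_zero_iff_right hα.ne'] at e
  simp only [Matrix.mul_assoc] at e ⊢
  exact e

theorem isStandardARESol_iff (hC : HasNoHiddenSubspace C A) :
    IsStandardARESol A B C D X ↔
      IsPSDARESol (A + (0 : ℝ) • (1 : Matrix (Fin n) (Fin n) ℝ)) (B * (Dᵀ * D)⁻¹ * Bᵀ)
        (Cᵀ * C) X := by
  rw [zero_smul, add_zero]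
  have e : X * B * (Dᵀ * D)⁻¹ * Bᵀ * X = X * (B * (Dᵀ * D)⁻¹ * Bᵀ) * X := by
    simp only [Matrix.mul_assoc]
  unfold IsStandardARESol
  rw [e]
  exact ⟨fun h => ⟨h.1.posSemidef, h.2⟩, fun h => ⟨h.posDef hC, h.2⟩⟩

end

/-! ### Traces and infimizing parameters -/

section
variable {n l : ℕ} {Bw : Matrix (Fin n) (Fin l) ℝ} {M N : Matrix (Fin n) (Fin n) ℝ}

theorem trace_transpose_mul_mul_nonneg (Bw : Matrix (Fin n) (Fin l) ℝ) (hM : M.PosSemidef) :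
    0 ≤ (Bwᵀ * M * Bw).trace := by
  have := hM.conjTranspose_mul_mul_same Bw
  rw [Matrix.conjTranspose_eq_transpose_of_trivial] at this
  exact this.trace_nonneg

theorem trace_transpose_mul_mul_le (Bw : Matrix (Fin n) (Fin l) ℝ) (h : (N - M).PosSemidef) :
    (Bwᵀ * M * Bw).trace ≤ (Bwᵀ * N * Bw).trace := by
  have := trace_transpose_mul_mul_nonneg Bw h
  rw [Matrix.mul_sub, Matrix.sub_mul, Matrix.trace_sub] at this
  linarith

theorem trace_transpose_mul_mul_pos (hBw : Bw ≠ 0) (hM : M.PosDef) :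
    0 < (Bwᵀ * M * Bw).trace := by
  have hjj : ∀ j, (Bwᵀ * M * Bw) j j = (Bwᵀ j) ⬝ᵥ M *ᵥ (Bwᵀ j) := by
    intro j
    have := dotProduct_transpose_mul_mul_mulVec Bw M Bw (Pi.single j 1) (Pi.single j 1)
    simp only [Matrix.mulVec_single_one, single_one_dotProduct] at this
    exact this
  have hne : ∃ j, Bwᵀ j ≠ 0 := by
    by_contra! hc
    apply hBw
    ext i j
    exact congrFun (hc j) i
  obtain ⟨j, hj⟩ := hne
  refine Finset.sum_pos' (fun i _ => ?_) ⟨j, Finset.mem_univ _, ?_⟩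
  · rw [Matrix.diag_apply, hjj]
    exact (posSemidef_real_iff.1 hM.posSemidef).2 _
  · rw [Matrix.diag_apply, hjj]
    simpa using hM.dotProduct_mulVec_pos hj

theorem trace_transpose_smul_mul (Bw : Matrix (Fin n) (Fin l) ℝ) (α : ℝ) :
    (Bwᵀ * (α • M) * Bw).trace = α * (Bwᵀ * M * Bw).trace := by
  rw [Matrix.mul_smul, Matrix.smul_mul, Matrix.trace_smul, smul_eq_mul]

end

theorem exists_isArginf {f : ℝ → ℝ} {S : Set ℝ} (hS : S.Nonempty) (hf : BddBelow (f '' S)) :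
    ∃ a, IsArginf f S a := by
  obtain ⟨u, -, hu, huS⟩ := exists_seq_tendsto_sInf (hS.image f) hf
  choose v hvS hv using huS
  obtain ⟨a, φ, hφ, ha⟩ := CompactSpace.tendsto_subseq (fun i => (v i : EReal))
  refine ⟨a, sInf (f '' S), isGLB_csInf (hS.image f) hf, v ∘ φ, fun i => hvS _, ha, ?_⟩
  refine (hu.comp hφ.tendsto_atTop).congr fun i => ?_
  simp [hv]

theorem IsArginf.pos_or_top {f : ℝ → ℝ} {S : Set ℝ} (hS : ∀ α ∈ S, 0 < α)
    (hf : Tendsto f (𝓝[>] 0) atTop) {a : EReal} (h : IsArginf f S a) :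
    a ≠ 0 ∧ ((∃ r : ℝ, 0 < r ∧ a = (r : EReal)) ∨ a = ⊤) := by
  obtain ⟨γ, -, u, huS, hua, hfu⟩ := h
  have h0 : 0 ≤ a := ge_of_tendsto' hua fun i => by exact_mod_cast (hS _ (huS i)).le
  have hne : a ≠ 0 := by
    rintro rfl
    have hu0 : Tendsto u atTop (𝓝 0) := by
      rw [← EReal.coe_zero] at hua
      exact EReal.tendsto_coe.1 hua
    have := hf.comp (tendsto_nhdsWithin_iff.2 ⟨hu0, Eventually.of_forall fun i => hS _ (huS i)⟩)
    exact not_tendsto_nhds_of_tendsto_atTop this γ hfu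
  refine ⟨hne, ?_⟩
  induction a with
  | bot => simp at h0
  | top => exact Or.inr rfl
  | coe r =>
    refine Or.inl ⟨r, lt_of_le_of_ne (by exact_mod_cast h0) fun h => hne ?_, rfl⟩
    rw [← h, EReal.coe_zero]

theorem mainTheorem11 {n m l k : ℕ}
    (A : Matrix (Fin n) (Fin n) ℝ) (B : Matrix (Fin n) (Fin m) ℝ)
    (Bw : Matrix (Fin n) (Fin l) ℝ) (C : Matrix (Fin k) (Fin n) ℝ)
    (D : Matrix (Fin k) (Fin m) ℝ)
    (hAB : IsStabilizable A B) (hCA : IsObservable C A)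
    (hCD : Cᵀ * D = 0) (hD : IsUnit (Dᵀ * D)) (hBw : Bw ≠ 0)
    (Q : ℝ → Matrix (Fin n) (Fin n) ℝ)
    (hQ : ∀ α ∈ riccatiDomain A B C D, IsRiccatiSol A B C D α (Q α)) :
    -- `Q α` is the only positive definite solution, and it exists for all small `α > 0`
    (∀ α ∈ riccatiDomain A B C D, ∀ X, IsRiccatiSol A B C D α X → X = Q α) ∧
    (∀ᶠ α in 𝓝[>] (0 : ℝ), α ∈ riccatiDomain A B C D) ∧
    -- `α Q α` tends to the positive definite solution of the standard Riccati equation,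
    -- and the trace blows up like `1 / α`
    (∃ Qhat, IsStandardARESol A B C D Qhat ∧
      (∀ X, IsStandardARESol A B C D X → X = Qhat) ∧
      Tendsto (fun α => α • Q α) (𝓝[>] (0 : ℝ)) (𝓝 Qhat) ∧
      0 < (Bwᵀ * Qhat * Bw).trace ∧
      Tendsto (fun α => α * (Bwᵀ * Q α * Bw).trace) (𝓝[>] (0 : ℝ))
        (𝓝 (Bwᵀ * Qhat * Bw).trace)) ∧
    Tendsto (fun α => (Bwᵀ * Q α * Bw).trace) (𝓝[>] (0 : ℝ)) atTop ∧
    -- infimizing parameters exist in `[0, ∞]`, and none of them is `0`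
    (∃ a, IsArginf (fun α => (Bwᵀ * Q α * Bw).trace) (riccatiDomain A B C D) a) ∧
    (∀ a, IsArginf (fun α => (Bwᵀ * Q α * Bw).trace) (riccatiDomain A B C D) a →
      a ≠ 0 ∧ ((∃ r : ℝ, 0 < r ∧ a = (r : EReal)) ∨ a = ⊤)) ∧
    -- an infimizing parameter at which the trace is defined is a minimizer
    (∀ r ∈ riccatiDomain A B C D,
      IsArginf (fun α => (Bwᵀ * Q α * Bw).trace) (riccatiDomain A B C D) (r : EReal) →
      ∀ α ∈ riccatiDomain A B C D, (Bwᵀ * Q r * Bw).trace ≤ (Bwᵀ * Q α * Bw).trace) := by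
  have hC := hCA.hasNoHiddenSubspace
  have hR : (Dᵀ * D).PosDef := by
    have h := Matrix.posSemidef_conjTranspose_mul_self D
    rw [Matrix.conjTranspose_eq_transpose_of_trivial] at h
    exact h.posDef_iff_isUnit.2 hD
  have hH : (Cᵀ * C).PosSemidef := by
    have h := Matrix.posSemidef_conjTranspose_mul_self C
    rwa [Matrix.conjTranspose_eq_transpose_of_trivial] at h
  have hG : (B * (Dᵀ * D)⁻¹ * Bᵀ).PosSemidef := by
    have h := hR.inv.posSemidef.mul_mul_conjTranspose_same B
    rwa [Matrix.conjTranspose_eq_transpose_of_trivial] at h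
  have hP : ∀ α ∈ riccatiDomain A B C D,
      IsPSDARESol (A + (α / 2) • (1 : Matrix (Fin n) (Fin n) ℝ)) (B * (Dᵀ * D)⁻¹ * Bᵀ) (Cᵀ * C)
        (α • Q α) := fun α hα => (hQ α hα).isPSDARESol hα.1
  have huniq : ∀ α ∈ riccatiDomain A B C D, ∀ X, IsRiccatiSol A B C D α X → X = Q α := by
    intro α hα X hX
    exact smul_right_injective _ hα.1.ne' ((hX.isPSDARESol hα.1).unique hG hC (hP α hα))
  obtain ⟨δ, hδ, hshift⟩ := hAB.exists_shift
  have hdom : ∀ α, 0 < α → α / 2 < δ → α ∈ riccatiDomain A B C D := by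
    intro α hα hαδ
    obtain ⟨X, hX⟩ := (hshift _ hαδ).exists_isPSDARESol hR hH
    exact ⟨hα, _, hX.isRiccatiSol hα hC⟩
  have hev : ∀ᶠ α in 𝓝[>] (0 : ℝ), α ∈ riccatiDomain A B C D := by
    filter_upwards [Ioo_mem_nhdsGT hδ] with α hα
    exact hdom α hα.1 (by linarith [hα.1, hα.2])
  obtain ⟨L, hL⟩ := (hshift 0 hδ).exists_isPSDARESol hR hH
  have hLpos : 0 < (Bwᵀ * L * Bw).trace :=
    trace_transpose_mul_mul_pos hBw (hL.posDef (hC.shift 0))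
  have hlim : Tendsto (fun α => α • Q α) (𝓝[>] (0 : ℝ)) (𝓝 L) := by
    have hc : Tendsto (fun α : ℝ => α / 2) (𝓝[>] (0 : ℝ)) (𝓝 0) := by
      have : Tendsto (fun α : ℝ => α / 2) (𝓝 (0 : ℝ)) (𝓝 (0 / 2)) := tendsto_id.div_const 2
      rw [zero_div] at this
      exact this.mono_left nhdsWithin_le_nhds
    -- The parameter `δ` lies in the domain because `δ / 2 < δ`, and by monotonicity its solution
    -- dominates those for smaller `α`.
    refine IsPSDARESol.tendsto_of_bounded (N := δ • Q δ) hG hC hc (hev.mono hP) ?_ hL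
    filter_upwards [hev, Ioo_mem_nhdsGT hδ] with α hα hαδ
    exact (hP δ (hdom δ hδ (by linarith))).sub_posSemidef (by linarith [hαδ.2]) hG hC (hP α hα)
  have htrcont : Continuous fun M : Matrix (Fin n) (Fin n) ℝ => (Bwᵀ * M * Bw).trace := by
    fun_prop
  have hlimtr : Tendsto (fun α => α * (Bwᵀ * Q α * Bw).trace) (𝓝[>] (0 : ℝ))
      (𝓝 (Bwᵀ * L * Bw).trace) :=
    ((htrcont.tendsto L).comp hlim).congr fun α => trace_transpose_smul_mul Bw α
  have hblow : Tendsto (fun α => (Bwᵀ * Q α * Bw).trace) (𝓝[>] (0 : ℝ)) atTop := by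
    refine (hlimtr.pos_mul_atTop hLpos tendsto_inv_nhdsGT_zero).congr' ?_
    filter_upwards [self_mem_nhdsWithin] with α hα
    rw [mul_comm α, mul_assoc, mul_inv_cancel₀ (ne_of_gt hα), mul_one]
  refine ⟨huniq, hev, ⟨L, (isStandardARESol_iff hC).2 hL,
    fun X hX => ((isStandardARESol_iff hC).1 hX).unique hG hC hL, hlim, hLpos, hlimtr⟩, hblow,
    exists_isArginf ⟨δ, hdom δ hδ (by linarith)⟩ ⟨0, ?_⟩,
    fun a ha => ha.pos_or_top (fun α hα => hα.1) hblow, ?_⟩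
  · rintro _ ⟨α, hα, rfl⟩
    exact trace_transpose_mul_mul_nonneg Bw (hQ α hα).1.posSemidef
  rintro r hr ⟨γ, hγ, u, huS, hur, hfu⟩ α hα
  refine le_trans ?_ (hγ.1 (Set.mem_image_of_mem _ hα))
  have hur' : Tendsto u atTop (𝓝 r) := EReal.tendsto_coe.1 hur
  have hprod : Tendsto (fun i => u i * (Bwᵀ * Q (u i) * Bw).trace) atTop (𝓝 (r * γ)) :=
    hur'.mul hfu
  -- Monotonicity is available for `α Q α`, not for `Q α`, so the comparison is made after
  -- multiplying by `r`.
  refine le_of_mul_le_mul_left ?_ hr.1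
  -- Parameters at or above `r` infinitely often give the inequality directly by monotonicity.
  -- Otherwise they are eventually below `r`, where `r • Q r` is an upper bound and continuity
  -- applies.
  by_cases hfreq : ∃ᶠ i in atTop, r ≤ u i
  · refine ge_of_tendsto_of_frequently hprod (hfreq.mono fun i hi => ?_)
    rw [← trace_transpose_smul_mul, ← trace_transpose_smul_mul]
    exact trace_transpose_mul_mul_le Bw
      ((hP _ (huS i)).sub_posSemidef (by linarith) hG hC (hP r hr))
  · rw [not_frequently] at hfreq
    have hQu : Tendsto (fun i => u i • Q (u i)) atTop (𝓝 (r • Q r)) :=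
      IsPSDARESol.tendsto_of_bounded (N := r • Q r) hG hC (hur'.div_const 2)
        (Eventually.of_forall fun i => hP _ (huS i))
        (hfreq.mono fun i hi => (hP r hr).sub_posSemidef (by linarith) hG hC (hP _ (huS i)))
        (hP r hr)
    have ht := (htrcont.tendsto _).comp hQu
    rw [trace_transpose_smul_mul] at ht
    exact (tendsto_nhds_unique (ht.congr fun i => trace_transpose_smul_mul Bw (u i)) hprod).le
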